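/- Let $m\ge 1$ be an integer and let $\Sigma_{m+1}=\{0,1,\dots,m\}^{\mathbb N}$ be the full one-sided shift space, with sequences written $x=(x_1,x_2,\dots)$. Equip it with the shift map $\sigma$, $(\sigma(x))_i=x_{i+1}$, with the lexicographic order ($a<b$ if and only if there is $i_0$ with $a_i=b_i$ for all $i<i_0$ and $a_{i_0}<b_{i_0}$), and with the metric $$d(a,b)=\sum_{i=1}^{\infty}\frac{|a_i-b_i|}{(m+1)^i}.$$ Then the set of kneading sequences $$M:=\{x\in\Sigma_{m+1} : \sigma^n(x)<x \text{ for all } n>0\}$$ has full Hausdorff dimension: $\dim_H(M)=\dim_H(\Sigma_{m+1})=1$. -/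

import Mathlib

/-- The full one-sided shift space on the alphabet `{0, 1, …, m}`. The coordinate with index `i : ℕ`
is the `(i + 1)`-st symbol of the sequence. -/
def FullShift (m : ℕ) : Type := ℕ → Fin (m + 1)

namespace FullShift

variable {m : ℕ}

/-- The left shift, which deletes the first symbol. -/
def shift (x : FullShift m) : FullShift m := fun i => x (i + 1)

/-- The strict lexicographic order. -/
instance instLT : LT (FullShift m) :=
  ⟨fun a b => ∃ i : ℕ, (∀ j : ℕ, j < i → a j = b j) ∧ a i < b i⟩

/-- The `i`-th term of the series that defines the distance. -/
noncomputable def distTerm (a b : FullShift m) (i : ℕ) : ℝ :=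
  |((a i : ℕ) : ℝ) - ((b i : ℕ) : ℝ)| / ((m : ℝ) + 1) ^ (i + 1)

theorem distTerm_nonneg (a b : FullShift m) (i : ℕ) : 0 ≤ distTerm a b i := by
  unfold distTerm; positivity

theorem summable_distTerm (a b : FullShift m) : Summable (distTerm a b) := by
  have hle : ∀ i, distTerm a b i ≤ (m : ℝ) * (1 / ((m : ℝ) + 1)) ^ (i + 1) := by
    intro i
    have h1 : ((a i : ℕ) : ℝ) ≤ m := by exact_mod_cast Nat.lt_succ_iff.mp (a i).isLt
    have h2 : ((b i : ℕ) : ℝ) ≤ m := by exact_mod_cast Nat.lt_succ_iff.mp (b i).isLt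
    have h3 : |((a i : ℕ) : ℝ) - ((b i : ℕ) : ℝ)| ≤ m := by
      rw [abs_le]
      constructor <;> linarith [Nat.cast_nonneg (α := ℝ) (a i : ℕ),
        Nat.cast_nonneg (α := ℝ) (b i : ℕ)]
    unfold distTerm
    rw [one_div, inv_pow, ← div_eq_mul_inv]
    gcongr
  refine Summable.of_nonneg_of_le (distTerm_nonneg a b) hle ?_
  rcases Nat.eq_zero_or_pos m with rfl | hm
  · simp
  · have hm' : (0 : ℝ) < m := by exact_mod_cast hm
    refine Summable.mul_left _ ((summable_nat_add_iff 1).mpr ?_)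
    refine summable_geometric_of_lt_one (by positivity) ?_
    rw [div_lt_one (by positivity)]
    linarith

/-- The metric `d(a, b) = ∑_{i ≥ 1} |a_i - b_i| / (m + 1)^i`. -/
noncomputable instance instMetricSpace : MetricSpace (FullShift m) where
  dist a b := ∑' i : ℕ, |((a i : ℕ) : ℝ) - ((b i : ℕ) : ℝ)| / ((m : ℝ) + 1) ^ (i + 1)
  dist_self a := by simp
  dist_comm a b := by simp only [abs_sub_comm]
  dist_triangle a b c := by
    have h := (summable_distTerm a b).tsum_add (summable_distTerm b c)
    change ∑' i, distTerm a c i ≤ ∑' i, distTerm a b i + ∑' i, distTerm b c i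
    rw [← h]
    refine (summable_distTerm a c).tsum_le_tsum (fun i => ?_)
      ((summable_distTerm a b).add (summable_distTerm b c))
    unfold distTerm
    rw [← add_div]
    gcongr
    exact abs_sub_le _ _ _
  eq_of_dist_eq_zero := by
    intro a b h
    change ∑' i, distTerm a b i = 0 at h
    funext i
    have h0 : distTerm a b i ≤ 0 := by
      rw [← h]
      exact (summable_distTerm a b).le_tsum i (fun j _ => distTerm_nonneg a b j)
    have h1 : distTerm a b i = 0 := le_antisymm h0 (distTerm_nonneg a b i)
    unfold distTerm at h1
    have h2 : ((m : ℝ) + 1) ^ (i + 1) ≠ 0 := by positivity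
    rw [div_eq_zero_iff, or_iff_left h2, abs_eq_zero, sub_eq_zero] at h1
    exact Fin.ext (by exact_mod_cast h1)

/-- The set of kneading sequences: every proper shift of the sequence is strictly smaller than the
sequence itself. -/
def kneadingSet (m : ℕ) : Set (FullShift m) :=
  {x | ∀ n : ℕ, 0 < n → shift^[n] x < x}

end FullShift

namespace FullShift

open Filter Topology Set MeasureTheory
open scoped ENNReal NNReal

variable {m : ℕ}

/-! The upper bound comes from covering the space by the `(m + 1) ^ n` cylinders of length `n`, each
of diameter at most `(m + 1)⁻¹ ^ n`. For the lower bound, fix `q > 0` and consider the sequences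
that start with `q + 1` letters `m` and have a `0` at every later multiple of `q + 1`. They are
kneading sequences, and their other entries, of density `q / (q + 1)`, are free. Reading the free
entries as base `m + 1` digits maps the kneading set onto `[0, 1]` and is Hölder of exponent `q / (q
+ 1)`, so the dimension is at least `q / (q + 1)`; let `q → ∞`. -/

theorem shift_iterate_apply (x : FullShift m) (n i : ℕ) : (shift^[n] x) i = x (n + i) := by
  induction n generalizing x with
  | zero => simp
  | succ n ih =>
    rw [Function.iterate_succ_apply, ih]
    change x (n + i + 1) = _
    congr 1
    omega

theorem dist_le_of_agree {x y : FullShift m} {n : ℕ} (h : ∀ i < n, x i = y i) :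
    dist x y ≤ (((m : ℝ) + 1) ^ n)⁻¹ := by
  -- The differences `|x i - y i|` are themselves base `m + 1` digits, so the distance is a digit
  -- expansion whose first `n` digits vanish.
  let δ : ℕ → Fin (m + 1) := fun i =>
    ⟨((x i : ℤ) - (y i : ℤ)).natAbs, by have := (x i).isLt; have := (y i).isLt; omega⟩
  have hδ : dist x y = Real.ofDigits δ := by
    change (∑' i, distTerm x y i) = ∑' i, Real.ofDigitsTerm δ i
    congr 1 with i
    simp only [distTerm, Real.ofDigitsTerm, δ, Nat.cast_natAbs, div_eq_mul_inv]
    push_cast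
    rfl
  have h0 : Real.ofDigits (fun _ => (0 : Fin (m + 1))) = 0 := by
    simp [Real.ofDigits, Real.ofDigitsTerm]
  have h1 := Real.abs_ofDigits_sub_ofDigits_le (x := δ) (y := fun _ => 0) (n := n) (by
    intro i hi
    ext
    simp [δ, h i hi])
  rw [h0, sub_zero, ← hδ, abs_of_nonneg dist_nonneg] at h1
  exact_mod_cast h1

theorem inv_pow_le_dist_of_ne {x y : FullShift m} {i : ℕ} (h : x i ≠ y i) :
    (((m : ℝ) + 1) ^ (i + 1))⁻¹ ≤ dist x y := by
  refine le_trans ?_ ((summable_distTerm x y).le_tsum i fun j _ => distTerm_nonneg x y j)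
  rw [distTerm, inv_eq_one_div]
  gcongr
  have h1 : ((x i : ℕ) : ℤ) - ((y i : ℕ) : ℤ) ≠ 0 := by
    intro h2
    exact h (Fin.ext (by omega))
  exact_mod_cast Int.one_le_abs h1

theorem dimH_univ_le_one (hm : 1 ≤ m) : dimH (univ : Set (FullShift m)) ≤ 1 := by
  borelize (FullShift m)
  have hdiam : ∀ (n : ℕ) (w : Fin n → Fin (m + 1)),
      Metric.ediam {x : FullShift m | ∀ i : Fin n, x i = w i} ≤ ((m : ℝ≥0∞) + 1)⁻¹ ^ n := by
    intro n w
    refine Metric.ediam_le fun x hx y hy => ?_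
    rw [edist_dist]
    refine (ENNReal.ofReal_le_ofReal (dist_le_of_agree (n := n) fun i hi => ?_)).trans_eq ?_
    · exact (hx ⟨i, hi⟩).trans (hy ⟨i, hi⟩).symm
    · rw [← inv_pow, ENNReal.ofReal_pow (by positivity), ENNReal.ofReal_inv_of_pos (by positivity),
        ENNReal.ofReal_add (by positivity) zero_le_one]
      simp
  have hlim : Tendsto (fun n : ℕ => ((m : ℝ≥0∞) + 1)⁻¹ ^ n) atTop (𝓝 0) := by
    refine ENNReal.tendsto_pow_atTop_nhds_zero_of_lt_one ?_
    rw [ENNReal.inv_lt_one]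
    exact_mod_cast Nat.lt_add_one_of_le hm
  have hμ := Measure.hausdorffMeasure_le_liminf_sum ((1 : ℝ≥0) : ℝ) (univ : Set (FullShift m))
    _ hlim (fun n (w : Fin n → Fin (m + 1)) => {x | ∀ i : Fin n, x i = w i})
    (Eventually.of_forall hdiam)
    (Eventually.of_forall fun n x _ => mem_iUnion.2 ⟨fun i => x i, fun _ => rfl⟩)
  refine dimH_le_of_hausdorffMeasure_ne_top (d := 1) (ne_top_of_le_ne_top ENNReal.one_ne_top ?_)
  -- At every level `n` the diameter bounds add up to exactly `1`.
  refine hμ.trans (liminf_le_of_frequently_le' (Frequently.of_forall fun n => ?_))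
  refine (Finset.sum_le_sum fun w _ => ?_).trans_eq
    (b := ∑ _ : Fin n → Fin (m + 1), ((m : ℝ≥0∞) + 1)⁻¹ ^ n) ?_
  · simpa using hdiam n w
  · simp only [Finset.sum_const, Finset.card_univ, Fintype.card_pi, Fintype.card_fin,
      Finset.prod_const, nsmul_eq_mul]
    push_cast
    rw [← mul_pow, ENNReal.mul_inv_cancel (by positivity) (by finiteness), one_pow]

/-- The `j`-th index of the form `i ≥ q + 1` with `q + 1 ∤ i`. -/
def freeIndex (q j : ℕ) : ℕ := (j / q + 1) * (q + 1) + (j % q + 1)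

theorem freeIndex_le {q : ℕ} (hq : 0 < q) (j : ℕ) :
    q * (freeIndex q j + 1) ≤ (q + 1) * j + q * (q + 3) := by
  have h := Nat.div_add_mod j q
  unfold freeIndex
  generalize j / q = a at *
  have : j % q < q := Nat.mod_lt _ hq
  generalize j % q = b at *
  subst h
  nlinarith

/-- The number in `[0, 1]` whose base `m + 1` digits are the entries of `x` at the indices
`freeIndex q j`. -/
noncomputable def readFree (q : ℕ) (x : FullShift m) : ℝ :=
  Real.ofDigits fun j => x (freeIndex q j)

/-- The sequence with entries `m` at the indices below `q + 1`, entries `0` at the later multiples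
of `q + 1`, and the entries of `z` elsewhere. -/
def fillFree (q : ℕ) (z : ℕ → Fin (m + 1)) : FullShift m := fun i =>
  if i < q + 1 then Fin.last m
  else if i % (q + 1) = 0 then 0
  else z ((i / (q + 1) - 1) * q + (i % (q + 1) - 1))

theorem fillFree_freeIndex {q : ℕ} (hq : 0 < q) (z : ℕ → Fin (m + 1)) (j : ℕ) :
    fillFree q z (freeIndex q j) = z j := by
  have hlt : j % q + 1 < q + 1 := Nat.succ_lt_succ (Nat.mod_lt _ hq)
  have hmod : freeIndex q j % (q + 1) = j % q + 1 := by
    rw [freeIndex, Nat.mul_add_mod_of_lt hlt]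
  have hdiv : freeIndex q j / (q + 1) = j / q + 1 := by
    rw [freeIndex, mul_comm, Nat.mul_add_div (by omega), Nat.div_eq_of_lt hlt, add_zero]
  have hge : ¬ freeIndex q j < q + 1 := by
    unfold freeIndex
    rw [add_mul, one_mul]
    omega
  rw [fillFree, if_neg hge, if_neg (by omega), hmod, hdiv]
  congr 1
  simp [Nat.div_add_mod']

/-- Every window of length `q + 1` starting at `n > 0` contains a forced `0`. So the shift first
differs from the sequence within the initial block of maximal letters `m`, where it can only be
smaller. -/
theorem fillFree_mem_kneadingSet (hm : 1 ≤ m) (q : ℕ) (z : ℕ → Fin (m + 1)) :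
    fillFree q z ∈ kneadingSet m := by
  intro n hn
  have hlast : ∀ i < q + 1, fillFree q z i = Fin.last m := fun i hi => if_pos hi
  have h0 : (0 : Fin (m + 1)) ≠ Fin.last m := Fin.ne_of_val_ne (by simp; omega)
  obtain ⟨t, ht, hnt⟩ : ∃ t < q + 1, (n + t) % (q + 1) = 0 := by
    -- Since `q ≡ -1` modulo `q + 1`, this is the residue of `-n`.
    refine ⟨(q * n) % (q + 1), Nat.mod_lt _ (by omega), ?_⟩
    rw [Nat.add_mod_mod, show n + q * n = (q + 1) * n by ring, Nat.mul_mod_right]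
  have hzero : fillFree q z (n + t) = 0 := by
    have : ¬ n + t < q + 1 := by
      intro h
      rw [Nat.mod_eq_of_lt h] at hnt
      omega
    rw [fillFree, if_neg this, if_pos hnt]
  have hex : ∃ t, (shift^[n] (fillFree q z)) t ≠ fillFree q z t := by
    refine ⟨t, ?_⟩
    rw [shift_iterate_apply, hzero, hlast t ht]
    exact h0
  classical
  have hle : Nat.find hex ≤ t := by
    refine Nat.find_min' hex ?_
    rw [shift_iterate_apply, hzero, hlast t ht]
    exact h0
  refine ⟨Nat.find hex, fun j hj => not_not.1 (Nat.find_min hex hj), ?_⟩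
  have hne := Nat.find_spec hex
  rw [hlast _ (by omega)] at hne ⊢
  exact lt_of_le_of_ne (Fin.le_last _) hne

/-- If the free entries first differ at the `j`-th one, the images are within `(m + 1) ^ (-j)`,
while the sequences are at least `(m + 1) ^ (-(freeIndex q j + 1))` apart. As `freeIndex q j` grows
like `j * (q + 1) / q`, the exponents match up to the additive `q + 3`, which becomes the constant.
-/
theorem holderWith_readFree {q : ℕ} (hq : 0 < q) :
    HolderWith (((m : ℝ≥0) + 1) ^ (q + 3)) ((q : ℝ≥0) / (q + 1))
      (readFree q : FullShift m → ℝ) := by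
  intro x y
  have key : dist (readFree q x) (readFree q y) ≤
      ((m : ℝ) + 1) ^ (q + 3) * dist x y ^ ((q : ℝ) / (q + 1)) := by
    by_cases hex : ∃ j, x (freeIndex q j) ≠ y (freeIndex q j)
    · classical
      have h1 : dist (readFree q x) (readFree q y) ≤ (((m : ℝ) + 1) ^ Nat.find hex)⁻¹ := by
        have := Real.abs_ofDigits_sub_ofDigits_le (x := fun j => x (freeIndex q j))
          (y := fun j => y (freeIndex q j)) (n := Nat.find hex)
          fun j hj => not_not.1 (Nat.find_min hex hj)
        exact_mod_cast this
      have h2 := inv_pow_le_dist_of_ne (Nat.find_spec hex)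
      have hidx := freeIndex_le hq (Nat.find hex)
      generalize Nat.find hex = j at *
      have hb : (1 : ℝ) ≤ (m : ℝ) + 1 := by linarith [Nat.cast_nonneg (α := ℝ) m]
      have hb0 : (0 : ℝ) < (m : ℝ) + 1 := by linarith
      have hidx' : (q : ℝ) * (freeIndex q j + 1) ≤ (q + 1) * j + q * (q + 3) := by
        exact_mod_cast hidx
      refine h1.trans ?_
      calc (((m : ℝ) + 1) ^ j)⁻¹ = ((m : ℝ) + 1) ^ (-(j : ℝ)) := by
            rw [Real.rpow_neg hb0.le, Real.rpow_natCast]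
        _ ≤ ((m : ℝ) + 1) ^ (((q + 3 : ℕ) : ℝ)
              + (-((freeIndex q j + 1 : ℕ) : ℝ)) * ((q : ℝ) / (q + 1))) := by
            refine Real.rpow_le_rpow_of_exponent_le hb ?_
            have hq1 : (0 : ℝ) < (q : ℝ) + 1 := by positivity
            have : ((freeIndex q j + 1 : ℕ) : ℝ) * ((q : ℝ) / (q + 1)) ≤ j + (q + 3) := by
              rw [mul_div_assoc', div_le_iff₀ hq1]
              push_cast
              nlinarith [Nat.cast_nonneg (α := ℝ) q]
            push_cast at this ⊢
            linarith
        _ = ((m : ℝ) + 1) ^ (q + 3)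
              * ((((m : ℝ) + 1) ^ (freeIndex q j + 1))⁻¹) ^ ((q : ℝ) / (q + 1)) := by
            rw [Real.rpow_add hb0, Real.rpow_natCast, Real.rpow_mul hb0.le,
              Real.rpow_neg hb0.le, Real.rpow_natCast]
        _ ≤ _ := by gcongr
    · push Not at hex
      have : readFree q x = readFree q y := by
        unfold readFree
        simp only [hex]
      rw [this, dist_self]
      positivity
  rw [edist_dist, edist_dist, ENNReal.ofReal_rpow_of_nonneg dist_nonneg (by positivity)]
  refine (ENNReal.ofReal_le_ofReal key).trans_eq ?_
  rw [ENNReal.ofReal_mul (by positivity), ENNReal.ofReal_pow (by positivity),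
    ENNReal.ofReal_add (by positivity) zero_le_one]
  simp

theorem le_dimH_kneadingSet (hm : 1 ≤ m) {q : ℕ} (hq : 0 < q) :
    (((q : ℝ≥0) / (q + 1) : ℝ≥0) : ℝ≥0∞) ≤ dimH (kneadingSet m) := by
  have hr : (0 : ℝ≥0) < (q : ℝ≥0) / (q + 1) := by positivity
  have hIcc : dimH (Icc (0 : ℝ) 1) = 1 := by
    rw [Real.dimH_of_nonempty_interior (by rw [interior_Icc]; exact nonempty_Ioo.2 one_pos)]
    simp
  have hsub : Icc (0 : ℝ) 1 ⊆ readFree q '' kneadingSet m := by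
    intro t ht
    obtain ⟨z, -, rfl⟩ := Real.ofDigits_SurjOn (b := m + 1) (by omega) ht
    refine ⟨fillFree q z, fillFree_mem_kneadingSet hm q z, ?_⟩
    simp only [readFree, fillFree_freeIndex hq]
  have h := (dimH_mono hsub).trans ((holderWith_readFree hq).dimH_image_le hr (kneadingSet m))
  rw [hIcc, ENNReal.le_div_iff_mul_le (Or.inl (ENNReal.coe_ne_zero.2 hr.ne'))
    (Or.inl ENNReal.coe_ne_top), one_mul] at h
  exact h

theorem one_le_dimH_kneadingSet (hm : 1 ≤ m) : 1 ≤ dimH (kneadingSet m) := by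
  have hlim : Tendsto (fun q : ℕ => (((q : ℝ≥0) / (q + 1) : ℝ≥0) : ℝ≥0∞)) atTop (𝓝 1) := by
    rw [← ENNReal.coe_one, ENNReal.tendsto_coe, ← NNReal.tendsto_coe]
    push_cast
    exact tendsto_natCast_div_add_atTop (1 : ℝ)
  refine le_of_tendsto hlim ?_
  filter_upwards [eventually_gt_atTop 0] with q hq using le_dimH_kneadingSet hm hq

end FullShift

theorem mainTheorem10 (m : ℕ) (hm : 1 ≤ m) :
    dimH (FullShift.kneadingSet m) = 1 ∧
      dimH (FullShift.kneadingSet m) = dimH (Set.univ : Set (FullShift m)) := by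
  have h1 := FullShift.one_le_dimH_kneadingSet hm
  have h2 := dimH_mono (Set.subset_univ (FullShift.kneadingSet m))
  have h3 := FullShift.dimH_univ_le_one hm
  exact ⟨le_antisymm (h2.trans h3) h1, le_antisymm h2 (h3.trans h1)⟩
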